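/- Let $H$ be a complex Hilbert space. Let $A$ be a (possibly unbounded) self-adjoint operator in $H$ with domain $D(A)$, and let $B$ be a bounded, everywhere defined, positive self-adjoint operator on $H$ (positive meaning $\langle Bx,x\rangle\ge 0$ for all $x\in H$). The products have their natural domains: $D(BA)=D(A)$ and $D(AB)=\{x\in H: Bx\in D(A)\}$. A densely defined operator $T$ in $H$ is called hyponormal if $D(T)\subseteq D(T^*)$ and $\|T^*x\|\le\|Tx\|$ for all $x\in D(T)$. The spectrum $\sigma(T)$ of an operator $T$ in $H$ is the set of all $\lambda\in\mathbb{C}$ for which it fails that $T-\lambda$ is injective and $(T-\lambda)^{-1}$ is an everywhere defined bounded operator on $H$. If $BA$ is hyponormal and $\sigma(BA)\neq\mathbb{C}$, then both $BA$ and $AB$ are self-adjoint and $AB=BA$ (as operators, with equal domains). -/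

import Mathlib

open scoped LinearPMap

namespace UnboundedOp

variable {H : Type*} [NormedAddCommGroup H] [InnerProductSpace ℂ H]

/-- The product `BA` of an everywhere defined bounded operator `B` with an unbounded operator `A`:
`D(BA) = D(A)` and `(BA) x = B (A x)`. -/
def mulLeft (B : H →L[ℂ] H) (A : H →ₗ.[ℂ] H) : H →ₗ.[ℂ] H :=
  (B : H →ₗ[ℂ] H).compPMap A

/-- The product `AB` of an unbounded operator `A` with an everywhere defined bounded operator `B`:
`D(AB) = {x | B x ∈ D(A)}` and `(AB) x = A (B x)`. -/
def mulRight (A : H →ₗ.[ℂ] H) (B : H →L[ℂ] H) : H →ₗ.[ℂ] H where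
  domain := A.domain.comap (B : H →ₗ[ℂ] H)
  toFun := A.toFun.comp ((B : H →ₗ[ℂ] H).restrict fun _ hx => hx)

/-- The operator `T - z`, with domain `D(T)`. -/
def subScalar (T : H →ₗ.[ℂ] H) (z : ℂ) : H →ₗ.[ℂ] H where
  domain := T.domain
  toFun := T.toFun - z • T.domain.subtype

/-- The spectrum of an unbounded operator `T`: a number `z` is *not* in the spectrum if and only if
`T - z` is injective and its inverse is an everywhere defined bounded operator. -/
def spectrum (T : H →ₗ.[ℂ] H) : Set ℂ :=
  {z | ¬ (Function.Injective (subScalar T z) ∧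
    ∃ R : H →L[ℂ] H, (subScalar T z).inverse = (R : H →ₗ[ℂ] H).toPMap ⊤)}

/-- An unbounded operator `T` is hyponormal if it is densely defined, `D(T) ⊆ D(T*)` and
`‖T* x‖ ≤ ‖T x‖` for all `x ∈ D(T)`. -/
def IsHyponormal [CompleteSpace H] (T : H →ₗ.[ℂ] H) : Prop :=
  Dense (T.domain : Set H) ∧
    ∃ hle : T.domain ≤ T†.domain, ∀ x : T.domain, ‖T† ⟨x, hle x.2⟩‖ ≤ ‖T x‖

end UnboundedOp

/-!
Write `T = BA`; since `B` is bounded and `A`, `B` are self-adjoint, `T† = AB` (`adjoint_mulLeft`),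
so it suffices to show that `T` is self-adjoint.

The resolvent set of `T` is open and nonempty, hence contains a nonreal point `z`, and then `z̄` is
in the resolvent set of `AB`. A resolvent of `AB` yields one of `BA` at the same nonzero point, as
soon as `BA` has some resolvent (`IsResolventAt.mulLeft_of_mulRight`); so `z̄` lies in the resolvent
set of `T` as well.

The core is that the Cayley transform `U = (T - z̄) (T - z)⁻¹ = 1 + (z - z̄) (T - z)⁻¹` is a
contraction (`norm_sub_conj_smul_le`). It is a bounded hyponormal operator, so `‖Uⁿ y‖` is
log-convex in `n` for every `y`. It satisfies `U B = B V`, where `V` is the Cayley transform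
of `AB` at `z`; as `AB` is symmetric for the semi-inner product `⟨B x, y⟩`, the operator `V`
preserves `⟨B x, x⟩`, and so the vectors `Uⁿ B w` stay bounded for each `w`. Finally `U y` is
`(z̄ / z) y` plus a vector in the range of `B`, where `|z̄ / z| = 1`, so the sequence `‖Uⁿ y‖` has
bounded increments. A log-convex sequence with this property cannot increase at its first step,
which gives `‖U y‖ ≤ ‖y‖`.

With the same bound at `z̄` this becomes `‖(T - z̄) x‖ = ‖(T - z) x‖` on `D(T)`. Hence `T` is
symmetric, and having both `z` and `z̄` in its resolvent set it is self-adjoint.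
-/

namespace UnboundedOp

variable {H : Type*} [NormedAddCommGroup H] [InnerProductSpace ℂ H]

/-! ### Resolvents of unbounded operators -/

/-- `R` is the bounded, everywhere defined inverse of `T - z`. -/
def IsResolventAt (T : H →ₗ.[ℂ] H) (z : ℂ) (R : H →L[ℂ] H) : Prop :=
  (∀ y, ∃ h : R y ∈ T.domain, T ⟨R y, h⟩ = z • R y + y) ∧
    ∀ x : T.domain, R (T x - z • (x : H)) = x

theorem exists_isResolventAt_of_notMem_spectrum {T : H →ₗ.[ℂ] H} {z : ℂ}
    (hz : z ∉ spectrum T) : ∃ R, IsResolventAt T z R := by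
  simp only [spectrum, Set.mem_ofPred_eq, not_not] at hz
  obtain ⟨hinj, R, hR⟩ := hz
  have hker : (subScalar T z).toFun.ker = ⊥ := LinearMap.ker_eq_bot.mpr hinj
  have key : ∀ x : T.domain, R (T x - z • (x : H)) = x := by
    intro x
    have hx : T x - z • (x : H) ∈ (subScalar T z).inverse.domain := by
      rw [hR]; trivial
    have h1 : (subScalar T z).inverse ⟨_, hx⟩ = x :=
      LinearPMap.inverse_apply_eq hker (x := x) rfl
    refine Eq.trans ?_ h1
    exact (hR.le.2 (x := ⟨_, hx⟩)
      (y := (⟨T x - z • (x : H), trivial⟩ : (⊤ : Submodule ℂ H))) rfl).symm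
  refine ⟨R, fun y => ?_, key⟩
  have hy : y ∈ LinearMap.range (subScalar T z).toFun := by
    rw [← LinearPMap.inverse_domain, hR]; trivial
  obtain ⟨x, hx⟩ := hy
  change T.domain at x
  have hx' : T x - z • (x : H) = y := hx
  have hRy : R y = x := by rw [← hx', key]
  have hmem : R y ∈ T.domain := hRy ▸ x.2
  refine ⟨hmem, ?_⟩
  have : (⟨R y, hmem⟩ : T.domain) = x := Subtype.ext hRy
  rw [this, hRy, ← hx']
  abel

/-- The resolvent set is open: `R (1 - (w - z) R)⁻¹` is the resolvent at `w`. -/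
theorem IsResolventAt.exists_of_norm_lt [CompleteSpace H] {T : H →ₗ.[ℂ] H} {z w : ℂ}
    {R : H →L[ℂ] H} (hR : IsResolventAt T z R) (hw : ‖(w - z) • R‖ < 1) :
    ∃ R', IsResolventAt T w R' := by
  obtain ⟨u, hu⟩ : IsUnit (1 - (w - z) • R) := isUnit_one_sub_of_norm_lt_one hw
  set S : H →L[ℂ] H := ↑u⁻¹ with hS
  have h1 : ∀ y, S y - (w - z) • R (S y) = y := fun y => by
    have : (u : H →L[ℂ] H) (S y) = y := by
      rw [hS, ← mul_apply_eq_comp, u.mul_inv]; rfl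
    rwa [hu] at this
  have h2 : ∀ y, S (y - (w - z) • R y) = y := fun y => by
    have : S ((u : H →L[ℂ] H) y) = y := by
      rw [hS, ← mul_apply_eq_comp, u.inv_mul]; rfl
    rwa [hu] at this
  have hcomm : ∀ y, S (R y) = R (S y) := fun y => by
    conv_lhs => rw [← h1 y, map_sub, map_smul]
    rw [h2]
  refine ⟨R * S, fun y => ?_, fun x => ?_⟩
  · obtain ⟨h, e⟩ := hR.1 (S y)
    refine ⟨h, ?_⟩
    change T ⟨R (S y), h⟩ = w • R (S y) + y
    rw [e]
    calc z • R (S y) + S y = z • R (S y) + (y + (w - z) • R (S y)) :=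
          congrArg _ (sub_eq_iff_eq_add.mp (h1 y))
      _ = w • R (S y) + y := by module
  · change R (S (T x - w • (x : H))) = x
    rw [← hcomm]
    have e : R (T x - w • (x : H)) = x - (w - z) • R x := by
      rw [show T x - w • (x : H) = (T x - z • (x : H)) - (w - z) • (x : H) by module,
        map_sub, hR.2, map_smul]
    rw [e, h2]

/-- An operator with a resolvent at `z` is closed, so a point `w` at which `T - w` is bijective
has a bounded inverse by the closed graph theorem. -/
theorem IsResolventAt.exists_of_bijective [CompleteSpace H] {T : H →ₗ.[ℂ] H} {z w : ℂ}
    {R : H →L[ℂ] H} (hR : IsResolventAt T z R)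
    (hinj : ∀ x : T.domain, T x = w • (x : H) → (x : H) = 0)
    (hsurj : ∀ y, ∃ x : T.domain, T x = w • (x : H) + y) :
    ∃ R', IsResolventAt T w R' := by
  have huniq : ∀ x x' : T.domain, T x - w • (x : H) = T x' - w • (x' : H) → (x : H) = x' := by
    intro x x' h
    rw [← sub_eq_zero]
    apply hinj (x - x')
    rw [LinearPMap.map_sub, ← sub_eq_zero]
    rw [← sub_eq_zero] at h
    rw [← h]
    push_cast
    module
  choose G hG using hsurj
  have hG' : ∀ y, T (G y) - w • (G y : H) = y := fun y => by rw [hG]; abel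
  let g : H →ₗ[ℂ] H :=
    { toFun := fun y => G y
      map_add' := fun y y' => huniq (G (y + y')) (G y + G y') (by
        rw [hG', LinearPMap.map_add, hG, hG]; push_cast; module)
      map_smul' := fun c y => huniq (G (c • y)) (c • G y) (by
        rw [hG', LinearPMap.map_smul, hG]; push_cast; module) }
  -- This form of the first resolvent identity expresses the inverse `g` through the bounded operator
  -- `R`, so that the graph of `g` is closed.
  have hid : ∀ y, g y = R (y + (w - z) • g y) := fun y => by
    have := hR.2 (G y)
    rw [hG] at this
    rw [show y + (w - z) • g y = w • (G y : H) + y - z • (G y : H) by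
      change y + (w - z) • (G y : H) = _; module, this]
    rfl
  refine ⟨ContinuousLinearMap.ofSeqClosedGraph (g := g) ?_, fun y => ?_, fun x => ?_⟩
  · intro u x v hu hgu
    have hlim : Filter.Tendsto (g ∘ u) Filter.atTop (nhds (R (x + (w - z) • v))) := by
      have h := (R.continuous.tendsto _).comp (hu.add (hgu.const_smul (w - z)))
      refine h.congr fun n => ?_
      simp only [Function.comp_apply]
      exact (hid _).symm
    have hv : v = R (x + (w - z) • v) := tendsto_nhds_unique hgu hlim
    obtain ⟨h, e⟩ := hR.1 (x + (w - z) • v)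
    have := huniq ⟨_, h⟩ (G x) (by
      rw [hG', e]
      simp only
      rw [← hv]; module)
    rw [hv]; exact this
  · refine ⟨(G y).2, ?_⟩
    exact hG y
  · refine huniq (G (T x - w • (x : H))) x ?_
    rw [hG']

theorem IsResolventAt.adjoint [CompleteSpace H] {T : H →ₗ.[ℂ] H} {z : ℂ} {R : H →L[ℂ] H}
    (hT : Dense (T.domain : Set H)) (hR : IsResolventAt T z R) :
    IsResolventAt T† (starRingEnd ℂ z) (ContinuousLinearMap.adjoint R) := by
  constructor
  · intro y
    have h : ∀ x : T.domain, inner ℂ (starRingEnd ℂ z • ContinuousLinearMap.adjoint R y + y) (x : H)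
        = inner ℂ (ContinuousLinearMap.adjoint R y) (T x) := by
      intro x
      have e : inner ℂ (ContinuousLinearMap.adjoint R y) (T x - z • (x : H)) = inner ℂ y (x : H) := by
        rw [ContinuousLinearMap.adjoint_inner_left, hR.2]
      rw [inner_sub_right, inner_smul_right] at e
      rw [inner_add_left, inner_smul_left, ← e, Complex.conj_conj]
      ring
    refine ⟨LinearPMap.mem_adjoint_domain_of_exists _ ⟨_, h⟩, ?_⟩
    exact LinearPMap.adjoint_apply_eq hT _ h
  · intro x
    refine ext_inner_right ℂ fun y => ?_
    obtain ⟨h, e⟩ := hR.1 y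
    have := LinearPMap.adjoint_isFormalAdjoint hT x ⟨R y, h⟩
    rw [ContinuousLinearMap.adjoint_inner_left, inner_sub_left, this, e, inner_smul_left,
      inner_add_right, inner_smul_right, Complex.conj_conj]
    simp

/-! ### Hyponormal operators -/

/-- Translates of a hyponormal operator are hyponormal. -/
theorem IsHyponormal.norm_adjoint_sub_smul_le [CompleteSpace H] {T : H →ₗ.[ℂ] H}
    (hT : IsHyponormal T) (z : ℂ) {x : H} (hx : x ∈ T.domain) (hx' : x ∈ T†.domain) :
    ‖T† ⟨x, hx'⟩ - starRingEnd ℂ z • x‖ ≤ ‖T ⟨x, hx⟩ - z • x‖ := by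
  obtain ⟨hd, hle, hn⟩ := hT
  have h1 := hn ⟨x, hx⟩
  have h2 := LinearPMap.adjoint_isFormalAdjoint hd ⟨x, hx'⟩ ⟨x, hx⟩
  simp only at h2
  rw [← sq_le_sq₀ (norm_nonneg _) (norm_nonneg _), @norm_sub_sq ℂ, @norm_sub_sq ℂ]
  have h3 : RCLike.re (inner ℂ (T† ⟨x, hx'⟩) (starRingEnd ℂ z • x)) =
      RCLike.re (inner ℂ (T ⟨x, hx⟩) (z • x)) := by
    rw [inner_smul_right, inner_smul_right, h2, ← inner_conj_symm x, ← map_mul, RCLike.conj_re]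
  have h4 : ‖starRingEnd ℂ z • x‖ = ‖z • x‖ := by simp [norm_smul]
  have h5 : ‖T† ⟨x, hx'⟩‖ ^ 2 ≤ ‖T ⟨x, hx⟩‖ ^ 2 := by gcongr
  rw [h3, h4]
  linarith

/-- The resolvents of a hyponormal operator are hyponormal. -/
theorem IsHyponormal.norm_adjoint_resolvent_le [CompleteSpace H] {T : H →ₗ.[ℂ] H} {z : ℂ}
    {R : H →L[ℂ] H} (hT : IsHyponormal T) (hR : IsResolventAt T z R) (y : H) :
    ‖ContinuousLinearMap.adjoint R y‖ ≤ ‖R y‖ := by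
  set v := ContinuousLinearMap.adjoint R y with hv
  obtain ⟨h, e⟩ := hR.1 v
  have h' : R v ∈ T†.domain := hT.2.1 h
  -- `R = R† K` for the contraction `K = (T - z)† R`, evaluated here at `R† y`.
  set k := T† ⟨R v, h'⟩ - starRingEnd ℂ z • R v with hk
  have hkn : ‖k‖ ≤ ‖v‖ := by
    have := hT.norm_adjoint_sub_smul_le z h h'
    rwa [e, add_sub_cancel_left] at this
  have hkR : ContinuousLinearMap.adjoint R k = R v := (hR.adjoint hT.1).2 ⟨R v, h'⟩
  have h1 : ‖v‖ * ‖v‖ ≤ ‖R y‖ * ‖v‖ := by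
    have e1 : inner ℂ v v = inner ℂ (R y) k := by
      nth_rw 1 [hv]
      rw [ContinuousLinearMap.adjoint_inner_left, ← hkR, ContinuousLinearMap.adjoint_inner_right]
    have e2 : ‖inner ℂ v v‖ = ‖v‖ * ‖v‖ := by
      rw [inner_self_eq_norm_sq_to_K]; simp [sq]
    rw [← e2, e1]
    exact (norm_inner_le_norm _ _).trans (by gcongr)
  rcases (norm_nonneg v).eq_or_lt with h0 | h0
  · rw [← h0]; positivity
  · exact le_of_mul_le_mul_right h1 h0

/-- The operators `1 + c R` are hyponormal for every bounded hyponormal `R`. -/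
theorem norm_adjoint_one_add_smul_le [CompleteSpace H] {R : H →L[ℂ] H} (c : ℂ)
    (hR : ∀ y, ‖ContinuousLinearMap.adjoint R y‖ ≤ ‖R y‖) (y : H) :
    ‖ContinuousLinearMap.adjoint (1 + c • R) y‖ ≤ ‖(1 + c • R) y‖ := by
  have e : ContinuousLinearMap.adjoint (1 + c • R) y =
      y + starRingEnd ℂ c • ContinuousLinearMap.adjoint R y := by
    refine ext_inner_right ℂ fun x => ?_
    simp [ContinuousLinearMap.adjoint_inner_left, inner_add_left,
      inner_smul_left, inner_smul_right]
  have e' : (1 + c • R) y = y + c • R y := rfl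
  rw [e, e', ← sq_le_sq₀ (norm_nonneg _) (norm_nonneg _), @norm_add_sq ℂ, @norm_add_sq ℂ]
  have h3 : RCLike.re (inner ℂ y (starRingEnd ℂ c • ContinuousLinearMap.adjoint R y)) =
      RCLike.re (inner ℂ y (c • R y)) := by
    rw [inner_smul_right, inner_smul_right, ContinuousLinearMap.adjoint_inner_right,
      ← inner_conj_symm, ← map_mul, RCLike.conj_re]
  have h4 : ‖starRingEnd ℂ c • ContinuousLinearMap.adjoint R y‖ ≤ ‖c • R y‖ := by
    rw [norm_smul, norm_smul, RCLike.norm_conj]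
    gcongr
    exact hR y
  have h5 := pow_le_pow_left₀ (norm_nonneg _) h4 2
  rw [h3]
  linarith

/-- A log-convex sequence with bounded increments does not increase at its first step: otherwise
it would grow geometrically. -/
theorem le_of_logConvex_of_increment_le {a : ℕ → ℝ} {C : ℝ} (h0 : ∀ n, 0 ≤ a n)
    (hconv : ∀ n, a (n + 1) ^ 2 ≤ a (n + 2) * a n) (hC : ∀ n, a (n + 1) ≤ a n + C) :
    a 1 ≤ a 0 := by
  by_contra! hlt
  have ha0 : 0 < a 0 := by
    rcases (h0 0).eq_or_lt with h | h
    · have := hconv 0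
      rw [← h] at this hlt
      simp only [zero_add, mul_zero] at this
      nlinarith
    · exact h
  set r := a 1 / a 0 with hr
  have hr1 : 1 < r := by rwa [hr, one_lt_div ha0]
  have key : ∀ n, 0 < a n ∧ r * a n ≤ a (n + 1) := by
    intro n
    induction n with
    | zero => exact ⟨ha0, by rw [hr, div_mul_cancel₀ _ ha0.ne']⟩
    | succ n ih =>
      obtain ⟨hp, hi⟩ := ih
      have hp' : 0 < a (n + 1) := lt_of_lt_of_le (by positivity) hi
      refine ⟨hp', le_of_mul_le_mul_right ?_ hp⟩
      calc r * a (n + 1) * a n = a (n + 1) * (r * a n) := by ring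
        _ ≤ a (n + 1) * a (n + 1) := by gcongr
        _ ≤ a (n + 2) * a n := by rw [← sq]; exact hconv n
  have hpow : ∀ n, r ^ n * a 0 ≤ a n := by
    intro n
    induction n with
    | zero => simp
    | succ n ih =>
      calc r ^ (n + 1) * a 0 = r * (r ^ n * a 0) := by ring
        _ ≤ r * a n := by gcongr
        _ ≤ _ := (key n).2
  have hbound : ∀ n, (r - 1) * a n ≤ C := fun n => by linarith [(key n).2, hC n]
  obtain ⟨n, hn⟩ := pow_unbounded_of_one_lt (C / ((r - 1) * a 0)) hr1
  rw [div_lt_iff₀ (mul_pos (by linarith) ha0)] at hn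
  have h1 := mul_le_mul_of_nonneg_left (hpow n) (by linarith : 0 ≤ r - 1)
  linarith [hbound n]

/-- Along the orbits of a bounded hyponormal operator the norm is log-convex. -/
theorem sq_norm_pow_succ_le [CompleteSpace H] {U : H →L[ℂ] H}
    (hU : ∀ y, ‖ContinuousLinearMap.adjoint U y‖ ≤ ‖U y‖) (y : H) (n : ℕ) :
    ‖(U ^ (n + 1)) y‖ ^ 2 ≤ ‖(U ^ (n + 2)) y‖ * ‖(U ^ n) y‖ := by
  set v := (U ^ n) y
  have e1 : (U ^ (n + 1)) y = U v := by rw [pow_succ']; rfl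
  have e2 : (U ^ (n + 2)) y = U (U v) := by rw [pow_succ', pow_succ']; rfl
  rw [e1, e2]
  have h : ‖inner ℂ (U v) (U v)‖ = ‖U v‖ ^ 2 := by
    rw [inner_self_eq_norm_sq_to_K]; simp
  rw [← h, ← ContinuousLinearMap.adjoint_inner_left]
  exact (norm_inner_le_norm _ _).trans (by gcongr; exact hU _)

/-! ### Adjoints and resolvents of the products -/

theorem adjoint_mulLeft [CompleteSpace H] {A : H →ₗ.[ℂ] H} {B : H →L[ℂ] H}
    (hA : IsSelfAdjoint A) (hB : (B : H →ₗ[ℂ] H).IsSymmetric) :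
    (mulLeft B A)† = mulRight A B := by
  have hd := hA.dense_domain
  have hd' : Dense ((mulLeft B A).domain : Set H) := hd
  have hA' : A† = A := hA
  refine (LinearPMap.eq_of_le_of_domain_eq ?_ ?_).symm
  · refine LinearPMap.IsFormalAdjoint.le_adjoint hd' fun x y => ?_
    have := LinearPMap.adjoint_isFormalAdjoint hd
    rw [hA'] at this
    change inner ℂ (B (A x)) (y : H) = inner ℂ (x : H) (A ⟨B y, y.2⟩)
    rw [← this x ⟨B y, y.2⟩]
    exact hB _ _
  · ext y
    change B y ∈ A.domain ↔ Continuous _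
    conv_lhs => rw [← hA']
    rw [LinearPMap.mem_adjoint_domain_iff]
    refine iff_of_eq (congrArg _ (funext fun x => ?_))
    exact hB y (A x)

/-- If `AB - w` and, at some other point, `BA - z` are boundedly invertible, then so is `BA - w`:
the formal inverse `w⁻¹ (B (AB - w)⁻¹ A - 1)` is defined on `D(A)`, and the resolvent at `z`
reduces every right-hand side to one in `D(A)`. -/
theorem IsResolventAt.mulLeft_of_mulRight [CompleteSpace H] {A : H →ₗ.[ℂ] H} {B : H →L[ℂ] H}
    {z w : ℂ} {R S : H →L[ℂ] H} (hw : w ≠ 0) (hR : IsResolventAt (mulLeft B A) z R)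
    (hS : IsResolventAt (mulRight A B) w S) : ∃ R', IsResolventAt (mulLeft B A) w R' := by
  refine hR.exists_of_bijective (fun x hx => ?_) fun y => ?_
  · change A.domain at x
    change B (A x) = w • (x : H) at hx
    have hm : B (A x) ∈ A.domain := hx ▸ (w • x).2
    have hABv : A ⟨B (A x), hm⟩ = w • A x := by
      rw [← LinearPMap.map_smul]
      congr 1
      exact Subtype.ext hx
    have h := hS.2 ⟨A x, hm⟩
    change S (A ⟨B (A x), hm⟩ - w • A x) = A x at h
    rw [hABv, sub_self, map_zero] at h
    rw [← h, map_zero] at hx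
    exact (smul_eq_zero.mp hx.symm).resolve_left hw
  · obtain ⟨h, e⟩ := hR.1 y
    change R y ∈ A.domain at h
    change B (A ⟨R y, h⟩) = z • R y + y at e
    set y' : A.domain := (w - z) • ⟨R y, h⟩ with hy'
    obtain ⟨hv, ev⟩ := hS.1 (A y')
    set v := S (A y')
    change B v ∈ A.domain at hv
    change A ⟨B v, hv⟩ = w • v + A y' at ev
    set q : A.domain := w⁻¹ • (⟨B v, hv⟩ - y') with hq
    have hAq : A q = v := by
      rw [hq, LinearPMap.map_smul, LinearPMap.map_sub, ev, add_sub_cancel_right,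
        inv_smul_smul₀ hw]
    have hBv : B v = w • (q : H) + (y' : H) := by
      rw [hq]; push_cast; rw [smul_inv_smul₀ hw]; abel
    refine ⟨(⟨R y, h⟩ + q : A.domain), ?_⟩
    change B (A (⟨R y, h⟩ + q)) = w • ((⟨R y, h⟩ + q : A.domain) : H) + y
    rw [LinearPMap.map_add, map_add, e, hAq, hBv, hy']
    push_cast
    module

/-- The resolvent set of `BA` is invariant under conjugation away from `0`: conjugation carries it
to the resolvent set of `(BA)† = AB`. -/
theorem IsResolventAt.conj_mulLeft [CompleteSpace H] {A : H →ₗ.[ℂ] H} {B : H →L[ℂ] H}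
    (hA : IsSelfAdjoint A) (hB : (B : H →ₗ[ℂ] H).IsSymmetric) {z : ℂ} {R : H →L[ℂ] H}
    (hz : z ≠ 0) (hR : IsResolventAt (mulLeft B A) z R) :
    ∃ R', IsResolventAt (mulLeft B A) (starRingEnd ℂ z) R' := by
  have hd : Dense ((mulLeft B A).domain : Set H) := hA.dense_domain
  have h := hR.adjoint hd
  rw [adjoint_mulLeft hA hB] at h
  exact hR.mulLeft_of_mulRight (by simpa using hz) h

/-! ### Cayley transforms of the products -/

/-- With `B = P†P`, the Cayley transform of `AB` preserves the seminorm `‖P x‖ = ⟨B x, x⟩ ^ (1/2)`,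
because `AB` is symmetric for the form `⟨B x, y⟩`. -/
theorem norm_map_cayley_mulRight [CompleteSpace H] {A : H →ₗ.[ℂ] H} {B P S : H →L[ℂ] H} {z : ℂ}
    (hA : IsSelfAdjoint A) (hP : ∀ x, B x = ContinuousLinearMap.adjoint P (P x))
    (hS : IsResolventAt (mulRight A B) z S) (x : H) :
    ‖P ((1 + (z - starRingEnd ℂ z) • S) x)‖ = ‖P x‖ := by
  obtain ⟨hv, ev⟩ := hS.1 x
  set v := S x with hvdef
  change B v ∈ A.domain at hv
  change A ⟨B v, hv⟩ = z • v + x at ev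
  set a := A ⟨B v, hv⟩
  have hx : x = a - z • v := by rw [ev]; abel
  have hVx : (1 + (z - starRingEnd ℂ z) • S) x = a - starRingEnd ℂ z • v := by
    change x + (z - starRingEnd ℂ z) • S x = _
    rw [← hvdef, ev]; module
  have hreal : starRingEnd ℂ (inner ℂ (P a) (P v)) = inner ℂ (P a) (P v) := by
    have h := LinearPMap.adjoint_isFormalAdjoint hA.dense_domain
    rw [show A† = A from hA] at h
    have e1 : inner ℂ (P a) (P v) = inner ℂ a (B v) := by
      rw [hP, ContinuousLinearMap.adjoint_inner_right]
    have e2 : inner ℂ (P v) (P a) = inner ℂ (B v) a := by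
      rw [hP, ContinuousLinearMap.adjoint_inner_left]
    rw [inner_conj_symm, e1, e2]
    exact (h ⟨B v, hv⟩ ⟨B v, hv⟩).symm
  have hre : RCLike.re (inner ℂ (P a) (starRingEnd ℂ z • P v)) =
      RCLike.re (inner ℂ (P a) (z • P v)) := by
    rw [inner_smul_right, inner_smul_right, ← hreal, ← map_mul, RCLike.conj_re, hreal]
  rw [hVx, hx, map_sub, map_sub, map_smul, map_smul,
    ← sq_eq_sq₀ (norm_nonneg _) (norm_nonneg _), @norm_sub_sq ℂ, @norm_sub_sq ℂ, hre]
  simp only [norm_smul, RCLike.norm_conj]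

/-- The Cayley transform `U = (T - z̄) (T - z)⁻¹` of the hyponormal operator `T = BA` is a
contraction. Since `U B = B V` for the Cayley transform `V` of `AB`, the orbits of `U` on the range
of `B` are bounded, so the relation `U y = (z̄ / z) y + (c / z) B A (T - z)⁻¹ y`, with
`c = z - z̄`, bounds the increments of `‖Uⁿ y‖`. -/
theorem norm_sub_conj_smul_le [CompleteSpace H] {A : H →ₗ.[ℂ] H} {B P R S : H →L[ℂ] H} {z : ℂ}
    (hA : IsSelfAdjoint A) (hP : ∀ x, B x = ContinuousLinearMap.adjoint P (P x)) (hz : z ≠ 0)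
    (hyp : IsHyponormal (mulLeft B A)) (hR : IsResolventAt (mulLeft B A) z R)
    (hS : IsResolventAt (mulRight A B) z S) (x : A.domain) :
    ‖B (A x) - starRingEnd ℂ z • (x : H)‖ ≤ ‖B (A x) - z • (x : H)‖ := by
  set c := z - starRingEnd ℂ z with hc
  set U : H →L[ℂ] H := 1 + c • R with hU
  set V : H →L[ℂ] H := 1 + c • S with hV
  have hUV : ∀ w, U (B w) = B (V w) := by
    intro w
    obtain ⟨hv, ev⟩ := hS.1 w
    change B (S w) ∈ A.domain at hv
    change A ⟨B (S w), hv⟩ = z • S w + w at ev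
    have h := hR.2 ⟨B (S w), hv⟩
    change R (B (A ⟨B (S w), hv⟩) - z • B (S w)) = B (S w) at h
    rw [ev, map_add, map_smul, add_sub_cancel_left] at h
    change B w + c • R (B w) = B (w + c • S w)
    rw [h, map_add, map_smul]
  have hUVn : ∀ n w, (U ^ n) (B w) = B ((V ^ n) w) := by
    intro n
    induction n with
    | zero => intro w; rfl
    | succ n ih =>
      intro w
      rw [pow_succ, pow_succ]
      change (U ^ n) (U (B w)) = B ((V ^ n) (V w))
      rw [hUV, ih]
  have hPV : ∀ n w, ‖P ((V ^ n) w)‖ = ‖P w‖ := by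
    intro n
    induction n with
    | zero => intro w; rfl
    | succ n ih =>
      intro w
      rw [pow_succ]
      change ‖P ((V ^ n) (V w))‖ = _
      rw [ih]
      exact norm_map_cayley_mulRight hA hP hS w
  have hbdd : ∀ n w, ‖(U ^ n) (B w)‖ ≤ ‖ContinuousLinearMap.adjoint P‖ * ‖P w‖ := by
    intro n w
    rw [hUVn, hP, ← hPV n w]
    exact ContinuousLinearMap.le_opNorm _ _
  -- The bound `‖U y‖ ≤ ‖y‖` at this `y` is the assertion.
  set y := B (A x) - z • (x : H) with hy
  have hRy : R y = x := hR.2 x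
  have hUy : U y = B (A x) - starRingEnd ℂ z • (x : H) := by
    change y + c • R y = _
    rw [hRy, hy, hc]; module
  have hrel : U y = (starRingEnd ℂ z / z) • y + (c / z) • B (A x) := by
    rw [hUy, hy, hc]
    match_scalars <;> field_simp
    ring
  have hinc : ∀ n, ‖(U ^ (n + 1)) y‖ ≤
      ‖(U ^ n) y‖ + ‖c / z‖ * (‖ContinuousLinearMap.adjoint P‖ * ‖P (A x)‖) := by
    intro n
    have e : (U ^ (n + 1)) y = (U ^ n) (U y) := by rw [pow_succ]; rfl
    rw [e, hrel, map_add, map_smul, map_smul]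
    refine (norm_add_le _ _).trans ?_
    rw [norm_smul, norm_smul, norm_div, RCLike.norm_conj, div_self (norm_ne_zero_iff.mpr hz),
      one_mul]
    gcongr
    exact hbdd n _
  have hUhyp : ∀ y, ‖ContinuousLinearMap.adjoint U y‖ ≤ ‖U y‖ :=
    norm_adjoint_one_add_smul_le c (hyp.norm_adjoint_resolvent_le hR)
  have := le_of_logConvex_of_increment_le (a := fun n => ‖(U ^ n) y‖) (fun n => norm_nonneg _)
    (sq_norm_pow_succ_le hUhyp y) hinc
  rw [← hUy]
  simpa using this

/-! ### Criteria for symmetry and self-adjointness -/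

/-- An operator is symmetric if `‖(T - z̄) x‖ = ‖(T - z) x‖` on its domain, for one nonreal `z`. -/
theorem isFormalAdjoint_self_of_norm_eq {T : H →ₗ.[ℂ] H} {z : ℂ}
    (hz : z ≠ starRingEnd ℂ z)
    (h : ∀ x : T.domain, ‖T x - starRingEnd ℂ z • (x : H)‖ = ‖T x - z • (x : H)‖) :
    T.IsFormalAdjoint T := by
  have him : z - starRingEnd ℂ z ≠ 0 := sub_ne_zero.mpr hz
  -- The quadratic form of `T` is real.
  have hq : ∀ x : T.domain, inner ℂ (T x) (x : H) = inner ℂ (x : H) (T x) := by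
    intro x
    have hx := congrArg (· ^ 2) (h x)
    simp only [@norm_sub_sq ℂ, inner_smul_right, norm_smul, RCLike.norm_conj] at hx
    rw [← inner_conj_symm (x : H)]
    generalize inner ℂ (T x) (x : H) = t at *
    have h1 : z.im * t.im = 0 := by
      simp at hx
      linarith
    have h2 : z.im ≠ 0 := fun h0 => hz (Complex.conj_eq_iff_im.mpr h0).symm
    exact (Complex.conj_eq_iff_im.mpr ((mul_eq_zero.mp h1).resolve_left h2)).symm
  intro x y
  have h1 := hq (x + y)
  have h2 := hq (x + Complex.I • y)
  simp only [LinearPMap.map_add, LinearPMap.map_smul, Submodule.coe_add, Submodule.coe_smul,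
    inner_add_left, inner_add_right, inner_smul_left, inner_smul_right, Complex.conj_I] at h1 h2
  rw [hq x, hq y] at h1 h2
  have h3 : Complex.I * Complex.I = -1 := Complex.I_mul_I
  have e1 : inner ℂ (T x) (y : H) + inner ℂ (T y) (x : H) =
      inner ℂ (x : H) (T y) + inner ℂ (y : H) (T x) := by linear_combination h1
  have e2 : inner ℂ (T x) (y : H) - inner ℂ (T y) (x : H) =
      inner ℂ (x : H) (T y) - inner ℂ (y : H) (T x) := by
    linear_combination -Complex.I * h2 + (inner ℂ (T x) (y : H) - inner ℂ (T y) (x : H) -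
      inner ℂ (x : H) (T y) + inner ℂ (y : H) (T x)) * h3
  linear_combination (e1 + e2) / 2

/-- A densely defined symmetric operator with both `z` and `z̄` in its resolvent set is
self-adjoint. -/
theorem isSelfAdjoint_of_isResolventAt [CompleteSpace H] {T : H →ₗ.[ℂ] H} {z : ℂ}
    {R R' : H →L[ℂ] H} (hd : Dense (T.domain : Set H)) (hT : T.IsFormalAdjoint T)
    (hR : IsResolventAt T z R) (hR' : IsResolventAt T (starRingEnd ℂ z) R') :
    IsSelfAdjoint T := by
  have hle : T ≤ T† := hT.le_adjoint hd
  refine (LinearPMap.eq_of_le_of_domain_eq hle (le_antisymm hle.1 fun x hx => ?_)).symm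
  obtain ⟨h, e⟩ := hR'.1 (T† ⟨x, hx⟩ - starRingEnd ℂ z • x)
  set q := R' (T† ⟨x, hx⟩ - starRingEnd ℂ z • x)
  have hadj := hR.adjoint hd
  have e1 := hadj.2 ⟨x, hx⟩
  have e2 := hadj.2 ⟨q, hle.1 h⟩
  rw [← hle.2 (x := ⟨q, h⟩) (y := ⟨q, hle.1 h⟩) rfl] at e2
  simp only at e1 e2
  rw [e, add_sub_cancel_left] at e2
  rw [← e1, e2]
  exact h

theorem exists_nonreal_norm_sub_smul_lt_one (z : ℂ) (R : H →L[ℂ] H) :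
    ∃ w : ℂ, w.im ≠ 0 ∧ ‖(w - z) • R‖ < 1 := by
  have hc : Filter.Tendsto (fun t : ℝ => ‖(((z + t * Complex.I : ℂ)) - z) • R‖)
      (nhdsWithin 0 {0}ᶜ) (nhds 0) := by
    have : Continuous (fun t : ℝ => ‖(((z + t * Complex.I : ℂ)) - z) • R‖) := by fun_prop
    simpa using (this.tendsto 0).mono_left nhdsWithin_le_nhds
  have h1 := hc.eventually_lt_const one_pos
  have h2 : ∀ᶠ t : ℝ in nhdsWithin 0 {0}ᶜ, t ≠ -z.im := by
    rcases eq_or_ne z.im 0 with h | h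
    · rw [h, neg_zero]; exact eventually_mem_nhdsWithin
    · exact nhdsWithin_le_nhds (isOpen_ne.mem_nhds fun e => h (by linarith))
  obtain ⟨t, ht1, ht2⟩ := (h1.and h2).exists
  refine ⟨z + t * Complex.I, fun h => ht2 ?_, ht1⟩
  simp at h
  linarith

end UnboundedOp

/-! ### Self-adjointness of the products -/

theorem mainTheorem5 {H : Type*} [NormedAddCommGroup H] [InnerProductSpace ℂ H] [CompleteSpace H]
    (A : H →ₗ.[ℂ] H) (B : H →L[ℂ] H) (hA : IsSelfAdjoint A) (hB : B.IsPositive)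
    (hyp : UnboundedOp.IsHyponormal (UnboundedOp.mulLeft B A))
    (hσ : UnboundedOp.spectrum (UnboundedOp.mulLeft B A) ≠ Set.univ) :
    IsSelfAdjoint (UnboundedOp.mulLeft B A) ∧ IsSelfAdjoint (UnboundedOp.mulRight A B) ∧
      UnboundedOp.mulRight A B = UnboundedOp.mulLeft B A := by
  have hBs : (B : H →ₗ[ℂ] H).IsSymmetric := hB.1
  have hadj := UnboundedOp.adjoint_mulLeft hA hBs
  obtain ⟨P, hP⟩ : ∃ P : H →L[ℂ] H, ∀ x, B x = ContinuousLinearMap.adjoint P (P x) := by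
    obtain ⟨P, hP⟩ := CStarAlgebra.nonneg_iff_eq_star_mul_self.mp
      ((ContinuousLinearMap.nonneg_iff_isPositive B).mpr hB)
    exact ⟨P, fun x => by rw [hP]; rfl⟩
  -- A nonreal point `z` of the resolvent set; its conjugate is then another one.
  obtain ⟨z₀, hz₀⟩ := (Set.ne_univ_iff_exists_notMem _).mp hσ
  obtain ⟨R₀, hR₀⟩ := UnboundedOp.exists_isResolventAt_of_notMem_spectrum hz₀
  obtain ⟨z, hz, hlt⟩ := UnboundedOp.exists_nonreal_norm_sub_smul_lt_one z₀ R₀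
  obtain ⟨R, hR⟩ := hR₀.exists_of_norm_lt hlt
  have hz0 : z ≠ 0 := fun h => hz (by rw [h, Complex.zero_im])
  obtain ⟨R', hR'⟩ := hR.conj_mulLeft hA hBs hz0
  have hS := hR.adjoint hyp.1
  have hS' := hR'.adjoint hyp.1
  rw [hadj] at hS hS'
  rw [Complex.conj_conj] at hS'
  have hsa : IsSelfAdjoint (UnboundedOp.mulLeft B A) := by
    refine UnboundedOp.isSelfAdjoint_of_isResolventAt hyp.1 ?_ hR hR'
    refine UnboundedOp.isFormalAdjoint_self_of_norm_eq
      (fun h => hz (Complex.conj_eq_iff_im.mp h.symm)) fun x => le_antisymm ?_ ?_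
    · exact UnboundedOp.norm_sub_conj_smul_le hA hP hz0 hyp hR hS' x
    · have := UnboundedOp.norm_sub_conj_smul_le hA hP (by simpa using hz0) hyp hR' hS x
      rwa [Complex.conj_conj] at this
  have heq : UnboundedOp.mulRight A B = UnboundedOp.mulLeft B A := hadj.symm.trans hsa
  exact ⟨hsa, heq ▸ hsa, heq⟩
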